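/- Let $(S,0)\subset(\mathbb C^3,0)$ be the germ of a surface, given by an equation $F=0$ with $F$ holomorphic near $0$, $F(0)=0$ and $F\not\equiv 0$. Suppose that $0$ is an isolated singular point of $S$, that $S$ has multiplicity $3$ at $0$ (that is, $F$ vanishes at $0$ to order exactly $3$), and that the tangent cone of $S$ at $0$ is the cone $\Gamma=\{f=0\}$ over a smooth plane cubic $C\subset\mathbb P^2$; that is, the cubic part $f$ of the Taylor expansion of $F$ at $0$ is a homogeneous polynomial of degree $3$ defining a smooth curve $C=\{f=0\}\subset\mathbb P^2$. Then $(S,0)$ is analytically equivalent to $(\Gamma,0)$: there are a biholomorphic map $\Phi$ between open neighbourhoods of $0$ in $\mathbb C^3$ with $\Phi(0)=0$, and a holomorphic function $u$ near $0$ with $u(0)\neq 0$, such that $f\circ\Phi=u\cdot F$ near $0$. In particular, $\Phi$ maps $S$ onto $\Gamma$ near $0$. -/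

import Mathlib

open Filter Topology Asymptotics

/-- A germ at the origin of a surface in `ℂ³`: the germ of complex space `(V(F), 𝒪/(F))` cut out
by one holomorphic equation `F` defined near `0`, with `F 0 = 0` and `F` not identically zero near
`0`. Surface germs in the smooth germ `(ℂ³, 0)` are principal, so this is the general surface germ;
two equations define the same germ when they agree near `0` up to a nowhere vanishing holomorphic
factor. (The reduced germs are those whose `eqn` generates a radical ideal.) -/
structure SurfaceGerm where
  /-- A local equation; only its values near `0` matter. -/
  eqn : (Fin 3 → ℂ) → ℂ
  analyticAt_eqn : AnalyticAt ℂ eqn 0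
  eqn_zero : eqn 0 = 0
  eqn_ne_zero : ¬ ∀ᶠ x in 𝓝 (0 : Fin 3 → ℂ), eqn x = 0

namespace SurfaceGerm

/-- In a punctured neighbourhood of the origin, the surface has no singular point, that is, no point
where the equation and its differential both vanish. -/
def HasIsolatedSingularity (S : SurfaceGerm) : Prop :=
  ∀ᶠ x in 𝓝[≠] (0 : Fin 3 → ℂ), ¬ (S.eqn x = 0 ∧ fderiv ℂ S.eqn x = 0)

/-- The origin is a point of multiplicity `d`: the equation vanishes at the origin to order
exactly `d`. -/
def HasMultiplicity (S : SurfaceGerm) (d : ℕ) : Prop :=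
  S.eqn =O[𝓝 0] (fun x => ‖x‖ ^ d) ∧ ¬ S.eqn =O[𝓝 0] (fun x => ‖x‖ ^ (d + 1))

/-- The tangent cone of the germ at the origin is the cone `f = 0`: the form `f` is the lowest
degree homogeneous part of the Taylor expansion of the equation. -/
def HasTangentCone (S : SurfaceGerm) (f : MvPolynomial (Fin 3) ℂ) : Prop :=
  ∃ d : ℕ, S.HasMultiplicity d ∧ f.IsHomogeneous d ∧
    (fun x => S.eqn x - MvPolynomial.eval x f) =O[𝓝 0] (fun x => ‖x‖ ^ (d + 1))

/-- Analytic equivalence of germs of surfaces in `(ℂ³, 0)`: a biholomorphic map `Φ` between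
neighbourhoods of the origin, fixing the origin, pulls the ideal of `T` back to the ideal of `S`.
In particular `x ∈ S ↔ Φ x ∈ T` for `x` near the origin. -/
def AnalyticallyEquivalent (S T : SurfaceGerm) : Prop :=
  ∃ Φ : OpenPartialHomeomorph (Fin 3 → ℂ) (Fin 3 → ℂ),
    (0 : Fin 3 → ℂ) ∈ Φ.source ∧ Φ 0 = 0 ∧
    AnalyticOnNhd ℂ Φ Φ.source ∧ AnalyticOnNhd ℂ Φ.symm Φ.target ∧
    ∃ u : (Fin 3 → ℂ) → ℂ, AnalyticAt ℂ u 0 ∧ u 0 ≠ 0 ∧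
      ∀ᶠ x in 𝓝 (0 : Fin 3 → ℂ), T.eqn (Φ x) = u x * S.eqn x

end SurfaceGerm

/-- The form `f` defines a smooth plane curve of degree `d` in `ℙ²` over `ℂ`: at every point of the
curve, given by homogeneous coordinates `x ≠ 0`, some partial derivative of `f` is nonzero. -/
structure IsSmoothPlaneCurve (f : MvPolynomial (Fin 3) ℂ) (d : ℕ) : Prop where
  pos : 0 < d
  isHomogeneous : f.IsHomogeneous d
  ne_zero : f ≠ 0
  smooth : ∀ x : Fin 3 → ℂ, x ≠ 0 → MvPolynomial.eval x f = 0 →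
    ∃ i, MvPolynomial.eval x (MvPolynomial.pderiv i f) ≠ 0

theorem eval_smul_of_isHomogeneous {f : MvPolynomial (Fin 3) ℂ} {d : ℕ}
    (hf : f.IsHomogeneous d) (c : ℂ) (x : Fin 3 → ℂ) :
    MvPolynomial.eval (c • x) f = c ^ d * MvPolynomial.eval x f := by
  rw [MvPolynomial.eval_eq, MvPolynomial.eval_eq, Finset.mul_sum]
  refine Finset.sum_congr rfl fun m hm => ?_
  have h : m.degree = d := by
    rw [Finsupp.degree_eq_weight_one]
    exact hf (MvPolynomial.mem_support_iff.mp hm)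
  rw [Finsupp.degree_apply] at h
  simp only [Pi.smul_apply, smul_eq_mul, mul_pow, Finset.prod_mul_distrib,
    Finset.prod_pow_eq_pow_sum, h]
  ring

/-- The germ at its vertex of the affine cone `f = 0` in `ℂ³` over the plane curve `f = 0`. -/
noncomputable def coneGerm (f : MvPolynomial (Fin 3) ℂ) (d : ℕ) (hf : IsSmoothPlaneCurve f d) :
    SurfaceGerm where
  eqn x := MvPolynomial.eval x f
  analyticAt_eqn := AnalyticOnNhd.eval_mvPolynomial f 0 (Set.mem_univ _)
  eqn_zero := by
    have h := eval_smul_of_isHomogeneous hf.isHomogeneous 0 0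
    rwa [zero_smul, zero_pow hf.pos.ne', zero_mul] at h
  eqn_ne_zero h := by
    refine hf.ne_zero (MvPolynomial.funext fun x => ?_)
    have ht : Tendsto (fun c : ℂ => c • x) (𝓝[≠] 0) (𝓝 0) := by
      have : Tendsto (fun c : ℂ => c • x) (𝓝 0) (𝓝 ((0 : ℂ) • x)) :=
        (continuous_id.smul continuous_const).tendsto 0
      rw [zero_smul] at this
      exact this.mono_left nhdsWithin_le_nhds
    obtain ⟨c, hc, hc0⟩ := ((ht.eventually h).and self_mem_nhdsWithin).exists
    rw [eval_smul_of_isHomogeneous hf.isHomogeneous] at hc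
    rw [map_zero]
    exact (mul_eq_zero.mp hc).resolve_left (pow_ne_zero d hc0)

/-! Write F = f + O(‖x‖⁴) and seek Φ(x) = x + v, where each v_k is a quadratic form in x whose
coefficients y depend analytically on x. Taylor's formula gives f(x + v) = f(x) + Σ ∂_k f(x) v_k +
R, where R, like F − f, is a combination of quartic monomials with analytic coefficients. Since the
curve is smooth, the ∂_k f are three quadrics with no common zero, so every quartic monomial has the
form Σ ∂_k f · (quadratic form) (`IsSmoothPlaneCurve.exists_mul_eq_sum_pderiv`). Matching the
factors of ∂_k f, it suffices to solve y + N(x, y) = β(x) with N(0, y) = 0, which the implicit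
function theorem does (`exists_analyticAt_add_eq`). Then f ∘ Φ = F exactly, and Φ is tangent to the
identity.

The statement on quartics is a dimension count: triples of quadratic forms have dimension 18,
quartic forms 15, and the syzygies are spanned by the three Koszul relations
(`exists_koszul_of_sum_mul_eq_zero`). -/

/-! ### Coprime pairs and regular sequences -/

/-- A depth argument by hand: comparing the expressions of xyv yields e with ep in the prime (x, y),
so e = mx + ny can be absorbed into the coefficients, after which x cancels. -/
theorem mem_span_pair_of_mul_mem {R : Type*} [CommRing R] [IsDomain R] [DecompositionMonoid R]
    {x y p q v : R} (hx : Prime x) (hxy : ¬ x ∣ y) (hP : (Ideal.span {x, y}).IsPrime)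
    (hp : p ∉ Ideal.span {x, y}) (hpq : IsRelPrime p q)
    (hxv : x * v ∈ Ideal.span {p, q}) (hyv : y * v ∈ Ideal.span {p, q}) :
    v ∈ Ideal.span {p, q} := by
  obtain ⟨a, b, hab⟩ := Ideal.mem_span_pair.1 hxv
  obtain ⟨c, d, hcd⟩ := Ideal.mem_span_pair.1 hyv
  have hxp : ¬ x ∣ p := fun h => hp (Ideal.mem_span_pair.2 (by
    obtain ⟨z, hz⟩ := h
    exact ⟨z, 0, by rw [hz]; ring⟩))
  have hp0 : p ≠ 0 := fun h => hp (h ▸ zero_mem _)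
  have h1 : p * (a * y - c * x) = q * (d * x - b * y) := by
    linear_combination y * hab - x * hcd
  obtain ⟨e, he⟩ : p ∣ d * x - b * y := hpq.dvd_of_dvd_mul_left (Dvd.intro _ h1)
  have heP : e ∈ Ideal.span {x, y} := by
    refine (hP.mem_or_mem ?_).resolve_left hp
    rw [← he]
    exact Ideal.mem_span_pair.2 ⟨d, -b, by ring⟩
  obtain ⟨m, n, hmn⟩ := Ideal.mem_span_pair.1 heP
  have h2 : x * (d - m * p) = (b + n * p) * y := by
    linear_combination he - p * hmn
  obtain ⟨s, hs⟩ := (hx.dvd_or_dvd (Dvd.intro _ h2)).resolve_right hxy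
  have h3 : x * (v - s * q) = (a - n * q) * p := by
    linear_combination -hab + q * hs
  obtain ⟨w, hw⟩ := (hx.dvd_or_dvd (Dvd.intro _ h3)).resolve_right hxp
  refine Ideal.mem_span_pair.2 ⟨w, s, ?_⟩
  apply mul_left_cancel₀ hx.ne_zero
  linear_combination -h3 - p * hw

/-- Makes r a nonzerodivisor modulo (p, q). Some power of (x, y) lies in (p, q, r), hence multiplies
v into (p, q); the exponent is then lowered one step at a time. -/
theorem mem_span_pair_of_mul_mem_of_le_radical {R : Type*} [CommRing R] [IsDomain R]
    [DecompositionMonoid R]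
    {x y p q r v : R} (hx : Prime x) (hxy : ¬ x ∣ y) (hP : (Ideal.span {x, y}).IsPrime)
    (hp : p ∉ Ideal.span {x, y}) (hpq : IsRelPrime p q)
    (hrad : Ideal.span {x, y} ≤ (Ideal.span {p, q, r}).radical)
    (hv : r * v ∈ Ideal.span {p, q}) : v ∈ Ideal.span {p, q} := by
  obtain ⟨k, hk⟩ := Ideal.exists_pow_le_of_le_radical_of_fg hrad
    (Submodule.fg_span (Set.toFinite _))
  have key : ∀ k : ℕ, (∀ w ∈ Ideal.span {x, y} ^ k, w * v ∈ Ideal.span {p, q}) →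
      v ∈ Ideal.span {p, q} := by
    intro k
    induction k with
    | zero => intro h; simpa using h 1 (by simp)
    | succ k ih =>
      refine fun h => ih fun w hw => mem_span_pair_of_mul_mem hx hxy hP hp hpq ?_ ?_
      · rw [← mul_assoc]
        exact h _ (by rw [pow_succ']; exact Ideal.mul_mem_mul (Ideal.subset_span (by simp)) hw)
      · rw [← mul_assoc]
        exact h _ (by rw [pow_succ']; exact Ideal.mul_mem_mul (Ideal.subset_span (by simp)) hw)
  refine key k fun w hw => ?_
  obtain ⟨a, b, c, rfl⟩ := Submodule.mem_span_triple.1 (hk hw)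
  have : (a • p + b • q + c • r) * v = (a * v) * p + (b * v) * q + c * (r * v) := by
    simp only [smul_eq_mul]; ring
  rw [this]
  exact add_mem (Ideal.mem_span_pair.2 ⟨_, _, rfl⟩) (Ideal.mul_mem_left _ _ hv)

/-- In a pencil spanned by two elements, all but finitely many members are prime to a given
element with no factor in common with both generators. -/
theorem exists_isRelPrime_add_mul {K R : Type*} [Field K] [Infinite K] [CommRing R] [IsDomain R]
    [UniqueFactorizationMonoid R] [Algebra K R] {p q r : R} (hp : p ≠ 0)
    (h : ∀ g, Irreducible g → g ∣ p → g ∣ q → ¬ g ∣ r) :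
    ∃ t : K, IsRelPrime p (q + t • r) := by
  classical
  have hfin : (⋃ g ∈ (UniqueFactorizationMonoid.factors p).toFinset,
      {t : K | g ∣ q + t • r}).Finite := by
    refine Set.Finite.biUnion (Finset.finite_toSet _) fun g hg => ?_
    have hg' := Multiset.mem_toFinset.1 hg
    have hirr := UniqueFactorizationMonoid.irreducible_of_factor g hg'
    have hdvd := UniqueFactorizationMonoid.dvd_of_mem_factors hg'
    -- If g divides two distinct members of the pencil, it divides r and q, which is excluded.
    refine Set.Subsingleton.finite fun s hs t ht => ?_
    by_contra hst
    have h1 : g ∣ (s - t) • r := by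
      have := dvd_sub hs ht
      rwa [add_sub_add_left_eq_sub, ← sub_smul] at this
    have hdr : ∀ (c : K) (z : R), g ∣ z → g ∣ c • z := fun c z hz => by
      rw [Algebra.smul_def]
      exact hz.mul_left _
    have h2 : g ∣ r := by
      have := hdr (s - t)⁻¹ _ h1
      rwa [smul_smul, inv_mul_cancel₀ (sub_ne_zero.2 hst), one_smul] at this
    refine h g hirr hdvd ?_ h2
    simpa using dvd_sub hs (hdr s r h2)
  obtain ⟨t, ht⟩ := hfin.exists_notMem
  refine ⟨t, WfDvdMonoid.isRelPrime_of_no_irreducible_factors (fun h => hp h.1)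
    fun g hg hgp hgq => ht ?_⟩
  obtain ⟨g', hg', hgg'⟩ := UniqueFactorizationMonoid.exists_mem_factors_of_dvd hp hg hgp
  simp only [Set.mem_iUnion]
  exact ⟨g', Multiset.mem_toFinset.2 hg', hgg'.dvd_iff_dvd_left.1 hgq⟩

/-! ### Quartic forms in the ideal of three quadrics -/

namespace MvPolynomial

theorem isPrime_span_X_zero_X_one (K : Type*) [Field K] :
    (Ideal.span {(X 0 : MvPolynomial (Fin 3) K), X 1}).IsPrime := by
  let φ : MvPolynomial (Fin 3) K →ₐ[K] Polynomial K := aeval ![0, 0, Polynomial.X]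
  let ψ : Polynomial K →ₐ[K] MvPolynomial (Fin 3) K := Polynomial.aeval (X 2)
  let I := Ideal.span {(X 0 : MvPolynomial (Fin 3) K), X 1}
  have h0 : X 0 ∈ I := Ideal.subset_span (by simp)
  have h1 : X 1 ∈ I := Ideal.subset_span (by simp)
  have h : (Ideal.Quotient.mkₐ K I).comp (ψ.comp φ) = Ideal.Quotient.mkₐ K I := by
    ext i
    fin_cases i
    · simpa [φ, ψ] using (Ideal.Quotient.eq_zero_iff_mem.2 h0).symm
    · simpa [φ, ψ] using (Ideal.Quotient.eq_zero_iff_mem.2 h1).symm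
    · simp [φ, ψ]
  have hI : I = RingHom.ker φ := by
    refine le_antisymm (Ideal.span_le.2 ?_) fun p hp => ?_
    · rintro _ (rfl | rfl) <;> simp [φ]
    · have := DFunLike.congr_fun h p
      rw [RingHom.mem_ker] at hp
      simp only [AlgHom.comp_apply, hp, map_zero] at this
      exact Ideal.Quotient.eq_zero_iff_mem.1 this.symm
  change I.IsPrime
  rw [hI]
  exact RingHom.ker_isPrime _

theorem homogeneousComponent_mul_of_isHomogeneous {σ R : Type*} [CommSemiring R] {n : ℕ}
    {q : MvPolynomial σ R} (hq : q.IsHomogeneous n) (u : MvPolynomial σ R) :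
    homogeneousComponent n (u * q) = C (coeff 0 u) * q := by
  classical
  induction u using MvPolynomial.induction_on' with
  | monomial d c =>
    rw [homogeneousComponent_of_mem ((isHomogeneous_monomial c rfl).mul hq)]
    rcases eq_or_ne d 0 with rfl | hd
    · simp
    · have : d.degree ≠ 0 := fun h => hd ((Finsupp.degree_eq_zero_iff d).1 h)
      rw [if_neg (by omega), coeff_monomial, if_neg hd]
      simp
  | add p r hp hr => rw [add_mul, map_add, hp, hr, coeff_add, C_add, add_mul]

theorem finrank_homogeneousSubmodule (K : Type*) [Field K] (n : ℕ) :
    Module.finrank K (homogeneousSubmodule (Fin 3) K n) = (n + 2).choose 2 := by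
  classical
  have hs : {d : Fin 3 →₀ ℕ | d.degree = n} =
      (Finset.finsuppAntidiag (Finset.univ : Finset (Fin 3)) n : Set (Fin 3 →₀ ℕ)) := by
    ext d
    simp [Finsupp.degree_eq_sum, Finset.mem_finsuppAntidiag]
  rw [homogeneousSubmodule_eq_finsupp_supported, hs,
    (AddMonoidAlgebra.supportedEquivFinsupp _).finrank_eq]
  simp only [Module.finrank_finsupp_self, Finset.coe_sort_coe, Fintype.card_coe]
  rw [Finset.card_finsuppAntidiag_nat_eq_choose]
  rw [Finset.card_univ, Fintype.card_fin, show 3 + n - 1 = n + 2 by omega, Nat.choose_symm_add]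

/-- In degree n only the constant terms of the coefficients contribute. -/
theorem IsHomogeneous.exists_of_mem_span_pair {σ R : Type*} [CommRing R] {n : ℕ}
    {p q r : MvPolynomial σ R} (hp : p.IsHomogeneous n) (hq : q.IsHomogeneous n)
    (hr : r.IsHomogeneous n) (h : r ∈ Ideal.span {p, q}) : ∃ a b : R, r = a • p + b • q := by
  obtain ⟨u, v, huv⟩ := Ideal.mem_span_pair.1 h
  refine ⟨coeff 0 u, coeff 0 v, ?_⟩
  have := congrArg (homogeneousComponent n) huv
  rw [map_add, homogeneousComponent_mul_of_isHomogeneous hp,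
    homogeneousComponent_mul_of_isHomogeneous hq, homogeneousComponent_eq_self hr] at this
  rw [← this, smul_eq_C_mul, smul_eq_C_mul]

/-- Exactness of the Koszul complex in the one degree needed: r is a nonzerodivisor modulo (p, q),
which gives c; coprimality of p and q then gives b and a. -/
theorem exists_koszul_of_sum_mul_eq_zero {p q r a b c : MvPolynomial (Fin 3) ℂ}
    (hp : p.IsHomogeneous 2) (hq : q.IsHomogeneous 2) (hr : r.IsHomogeneous 2)
    (hb : b.IsHomogeneous 2) (hc : c.IsHomogeneous 2)
    (hpP : p ∉ Ideal.span {X 0, X 1}) (hpq : IsRelPrime p q)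
    (hrad : Ideal.span {X 0, X 1} ≤ (Ideal.span {p, q, r}).radical)
    (h : a * p + b * q + c * r = 0) :
    ∃ α β γ : ℂ, a = -(α • r) - γ • q ∧ b = γ • p - β • r ∧ c = α • p + β • q := by
  have hcI : c ∈ Ideal.span {p, q} := by
    refine mem_span_pair_of_mul_mem_of_le_radical (X_prime (i := 0)) ?_
      (isPrime_span_X_zero_X_one ℂ) hpP hpq hrad ?_
    · rw [X_dvd_X]; simp
    · exact Ideal.mem_span_pair.2 ⟨-a, -b, by linear_combination -h⟩
  obtain ⟨α, β, hαβ⟩ := hp.exists_of_mem_span_pair hq hc hcI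
  have hp0 : p ≠ 0 := fun h => hpP (h ▸ zero_mem _)
  have h1 : p * (-(a + α • r)) = q * (b + β • r) := by
    rw [hαβ] at h
    simp only [smul_eq_C_mul] at h ⊢
    linear_combination -h
  -- The generator 0 lets the lemma on pairs treat a principal ideal.
  have h2 : b + β • r ∈ Ideal.span {p, 0} := by
    obtain ⟨e, he⟩ := hpq.dvd_of_dvd_mul_left (Dvd.intro _ h1)
    exact Ideal.mem_span_pair.2 ⟨e, 0, by rw [he]; ring⟩
  obtain ⟨γ, _, hγ⟩ := hp.exists_of_mem_span_pair (isHomogeneous_zero _ _ _)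
    (hb.add ((homogeneousSubmodule (Fin 3) ℂ 2).smul_mem β hr)) h2
  rw [smul_zero, add_zero] at hγ
  refine ⟨α, β, γ, ?_, by rw [← hγ]; ring, hαβ⟩
  apply mul_left_cancel₀ hp0
  rw [hγ] at h1
  simp only [smul_eq_C_mul] at h1 ⊢
  linear_combination -h1

/-- A quartic ternary form lies in the ideal of three quadratic forms of which the first two have
no common factor and which together have no common zero. -/
theorem exists_eq_mul_add_mul_add_mul {p q r : MvPolynomial (Fin 3) ℂ}
    (hp : p.IsHomogeneous 2) (hq : q.IsHomogeneous 2) (hr : r.IsHomogeneous 2)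
    (hpP : p ∉ Ideal.span {X 0, X 1}) (hpq : IsRelPrime p q)
    (hrad : Ideal.span {X 0, X 1} ≤ (Ideal.span {p, q, r}).radical)
    {g : MvPolynomial (Fin 3) ℂ} (hg : g.IsHomogeneous 4) :
    ∃ a b c : MvPolynomial (Fin 3) ℂ, a.IsHomogeneous 2 ∧ b.IsHomogeneous 2 ∧
      c.IsHomogeneous 2 ∧ g = a * p + b * q + c * r := by
  let V := homogeneousSubmodule (Fin 3) ℂ 2
  let W := homogeneousSubmodule (Fin 3) ℂ 4
  have hV : Module.finrank ℂ V = 6 := finrank_homogeneousSubmodule ℂ 2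
  have hW : Module.finrank ℂ W = 15 := finrank_homogeneousSubmodule ℂ 4
  have : Module.Finite ℂ V := Module.Finite.iff_fg.2 (homogeneousSubmodule_fg _ _ _)
  have : Module.Finite ℂ W := Module.Finite.iff_fg.2 (homogeneousSubmodule_fg _ _ _)
  let T₀ : V × V × V →ₗ[ℂ] MvPolynomial (Fin 3) ℂ :=
    (LinearMap.mulRight ℂ p ∘ₗ V.subtype).coprod
      ((LinearMap.mulRight ℂ q ∘ₗ V.subtype).coprod (LinearMap.mulRight ℂ r ∘ₗ V.subtype))
  have hT₀ : ∀ x, T₀ x = x.1 * p + (x.2.1 * q + x.2.2 * r) := fun x => rfl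
  let T : V × V × V →ₗ[ℂ] W := T₀.codRestrict W fun x => by
    rw [hT₀]
    exact (x.1.2.mul hp).add ((x.2.1.2.mul hq).add (x.2.2.2.mul hr))
  let p' : V := ⟨p, hp⟩
  let q' : V := ⟨q, hq⟩
  let r' : V := ⟨r, hr⟩
  have hker : LinearMap.ker T ≤
      Submodule.span ℂ (Set.range ![(-r', 0, p'), (0, -r', q'), (-q', p', 0)]) := by
    rintro ⟨a, b, c⟩ h
    have h' : (a : MvPolynomial (Fin 3) ℂ) * p + b * q + c * r = 0 := by
      rw [LinearMap.mem_ker] at h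
      rw [add_assoc]
      exact congrArg Subtype.val h
    obtain ⟨α, β, γ, h1, h2, h3⟩ :=
      exists_koszul_of_sum_mul_eq_zero hp hq hr b.2 c.2 hpP hpq hrad h'
    rw [Submodule.mem_span_range_iff_exists_fun]
    refine ⟨![α, β, γ], ?_⟩
    simp only [Fin.sum_univ_three, Matrix.cons_val]
    refine Prod.ext (Subtype.ext ?_) (Prod.ext (Subtype.ext ?_) (Subtype.ext ?_))
    · simp [h1, p', q', r', sub_eq_add_neg]
    · simp [h2, p', q', r', sub_eq_add_neg, add_comm]
    · simp [h3, p', q', r']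
  have hkerdim : Module.finrank ℂ (LinearMap.ker T) ≤ 3 :=
    (Submodule.finrank_mono hker).trans (finrank_range_le_card _)
  have hrank := T.finrank_range_add_finrank_ker
  rw [Module.finrank_prod, Module.finrank_prod, hV] at hrank
  -- The rank is at least 18 − 3 = 15, the dimension of `W`.
  have htop : LinearMap.range T = ⊤ :=
    Submodule.eq_top_of_finrank_eq (le_antisymm (Submodule.finrank_le _) (by omega))
  obtain ⟨⟨a, b, c⟩, habc⟩ := LinearMap.range_eq_top.1 htop ⟨g, hg⟩
  refine ⟨a, b, c, a.2, b.2, c.2, ?_⟩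
  rw [add_assoc]
  exact (congrArg Subtype.val habc).symm

/-- Otherwise the Nullstellensatz makes g divide a power of each variable, hence two non-associated
primes. -/
theorem exists_eval_eq_zero_of_irreducible {g : MvPolynomial (Fin 3) ℂ} (hg : Irreducible g) : ∃ x, x ≠ 0 ∧ eval x g = 0 := by
  by_contra! h
  have hrad : ∀ i, X i ∈ (Ideal.span {g}).radical := by
    intro i
    rw [← vanishingIdeal_zeroLocus_eq_radical (K := ℂ), mem_vanishingIdeal_iff]
    intro x hx
    have hx0 : x = 0 := by
      by_contra hx0
      exact h x hx0 (by simpa using hx g (Ideal.mem_span_singleton_self g))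
    simp [hx0]
  have hdvd : ∀ i, g ∣ X i := fun i => by
    obtain ⟨n, hn⟩ := hrad i
    exact hg.prime.dvd_of_dvd_pow (Ideal.mem_span_singleton.1 hn)
  have h01 := (hg.dvd_symm (X_prime (i := (0 : Fin 3)) (R := ℂ)).irreducible (hdvd 0)).trans
    (hdvd 1)
  rw [X_dvd_X] at h01
  simp at h01

/-- Replacing q by a general q + tr makes it coprime to p without changing the ideal. Nonvanishing
at (0, 0, 1) keeps p out of (X₀, X₁). -/
theorem exists_eq_of_eval_ne_zero {p q r : MvPolynomial (Fin 3) ℂ}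
    (hp : p.IsHomogeneous 2) (hq : q.IsHomogeneous 2) (hr : r.IsHomogeneous 2)
    (hzero : ∀ x, eval x p = 0 → eval x q = 0 → eval x r = 0 → x = 0)
    (hpe : eval ![0, 0, 1] p ≠ 0) {g : MvPolynomial (Fin 3) ℂ} (hg : g.IsHomogeneous 4) :
    ∃ a b c : MvPolynomial (Fin 3) ℂ, a.IsHomogeneous 2 ∧ b.IsHomogeneous 2 ∧
      c.IsHomogeneous 2 ∧ g = a * p + b * q + c * r := by
  have hpP : p ∉ Ideal.span {X 0, X 1} := fun h => hpe (by
    obtain ⟨a, b, rfl⟩ := Ideal.mem_span_pair.1 h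
    simp)
  have hp0 : p ≠ 0 := fun h => hpP (h ▸ zero_mem _)
  obtain ⟨t, ht⟩ : ∃ t : ℂ, IsRelPrime p (q + t • r) := by
    refine exists_isRelPrime_add_mul hp0 fun g hg hgp hgq hgr => ?_
    have key : ∀ {s x}, g ∣ s → eval x g = 0 → eval x s = 0 := by
      rintro _ x ⟨w, rfl⟩ hx
      rw [map_mul, hx, zero_mul]
    obtain ⟨x, hx, hgx⟩ := exists_eval_eq_zero_of_irreducible hg
    exact hx (hzero x (key hgp hgx) (key hgq hgx) (key hgr hgx))
  have hrad : Ideal.span {X 0, X 1} ≤ (Ideal.span {p, q + t • r, r}).radical := by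
    rw [← vanishingIdeal_zeroLocus_eq_radical (K := ℂ), Ideal.span_le]
    have hx0 : ∀ x ∈ zeroLocus ℂ (Ideal.span {p, q + t • r, r}), x = 0 := by
      intro x hx
      rw [zeroLocus_span] at hx
      simp only [Set.mem_insert_iff, Set.mem_singleton_iff, forall_eq_or_imp, forall_eq,
        Set.mem_ofPred_eq, map_add, map_smul] at hx
      simp only [aeval_eq_eval] at hx
      refine hzero x hx.1 ?_ hx.2.2
      simpa [hx.2.2] using hx.2.1
    rintro _ (rfl | rfl) x hx <;> simp [hx0 x hx]
  obtain ⟨a, b, c, ha, hb, hc, h⟩ := exists_eq_mul_add_mul_add_mul hp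
    (hq.add ((homogeneousSubmodule (Fin 3) ℂ 2).smul_mem t hr)) hr hpP ht hrad hg
  refine ⟨a, b, c + t • b, ha, hb,
    hc.add ((homogeneousSubmodule (Fin 3) ℂ 2).smul_mem t hb), ?_⟩
  rw [h]
  simp only [smul_eq_C_mul]
  ring

/-! ### Euler's formula and forms in coordinates -/

theorem pderiv_pderiv_comm {σ R : Type*} [CommRing R] (i j : σ) (p : MvPolynomial σ R) :
    pderiv i (pderiv j p) = pderiv j (pderiv i p) := by
  classical
  have h : ⁅pderiv (R := R) i, pderiv (R := R) j⁆ = 0 := by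
    refine derivation_ext fun k => ?_
    rw [Derivation.commutator_apply, pderiv_X, pderiv_X]
    simp [Pi.single_apply, apply_ite]
  have := DFunLike.congr_fun h p
  rwa [Derivation.commutator_apply, Derivation.zero_apply, sub_eq_zero] at this

theorem IsHomogeneous.eval_eq_eval_zero {p : MvPolynomial (Fin 3) ℂ} (hp : p.IsHomogeneous 0)
    (x : Fin 3 → ℂ) : eval x p = eval 0 p := by
  obtain ⟨c, rfl⟩ : ∃ c, p = C c := ⟨_, totalDegree_eq_zero_iff_eq_C.1 ((totalDegree_zero_iff_isHomogeneous _).2 hp)⟩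
  simp

theorem IsHomogeneous.natCast_mul_eval {n : ℕ} {p : MvPolynomial (Fin 3) ℂ}
    (hp : p.IsHomogeneous n) (x : Fin 3 → ℂ) :
    n * eval x p = ∑ i, x i * eval x (pderiv i p) := by
  have := congrArg (eval x) hp.sum_X_mul_pderiv
  simpa using this.symm

theorem IsHomogeneous.eval_eq_sum_of_two {p : MvPolynomial (Fin 3) ℂ} (hp : p.IsHomogeneous 2)
    (x : Fin 3 → ℂ) :
    eval x p = ∑ i, ∑ j, 1 / 2 * eval 0 (pderiv j (pderiv i p)) * x i * x j := by
  have h1 := hp.natCast_mul_eval x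
  have h2 : ∀ i, eval x (pderiv i p) = ∑ j, x j * eval 0 (pderiv j (pderiv i p)) := fun i => by
    have := (hp.pderiv (i := i)).natCast_mul_eval x
    simp only [fun j => ((hp.pderiv (i := i)).pderiv (i := j)).eval_eq_eval_zero x] at this
    simpa using this
  simp only [h2, Fin.sum_univ_three] at h1 ⊢
  linear_combination h1 / 2

theorem exists_eval_eq_of_isHomogeneous_two {p : MvPolynomial (Fin 3) ℂ}
    (hp : p.IsHomogeneous 2) :
    ∃ D : Fin 3 → Fin 3 → ℂ, ∀ x, eval x p = ∑ i, ∑ j, D i j * x i * x j :=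
  ⟨_, fun x => hp.eval_eq_sum_of_two x⟩

theorem exists_eq_sum_mul_of_isHomogeneous_four {q : Fin 3 → MvPolynomial (Fin 3) ℂ}
    (hq : ∀ i, (q i).IsHomogeneous 2) (hzero : ∀ x, (∀ i, eval x (q i) = 0) → x = 0)
    {g : MvPolynomial (Fin 3) ℂ} (hg : g.IsHomogeneous 4) :
    ∃ a : Fin 3 → MvPolynomial (Fin 3) ℂ, (∀ i, (a i).IsHomogeneous 2) ∧
      g = ∑ i, a i * q i := by
  -- A quadric not vanishing at (0, 0, 1) takes the role of p.
  obtain ⟨i, hi⟩ : ∃ i, eval ![0, 0, 1] (q i) ≠ 0 := by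
    by_contra! h
    have := congrFun (hzero _ h) 2
    simp at this
  have hz : ∀ x, eval x (q 0) = 0 → eval x (q 1) = 0 → eval x (q 2) = 0 → x = 0 :=
    fun x h0 h1 h2 => hzero x fun i => by fin_cases i <;> assumption
  have key : ∀ a b c : MvPolynomial (Fin 3) ℂ, a.IsHomogeneous 2 → b.IsHomogeneous 2 →
      c.IsHomogeneous 2 → g = a * q 0 + b * q 1 + c * q 2 →
      ∃ a : Fin 3 → MvPolynomial (Fin 3) ℂ, (∀ i, (a i).IsHomogeneous 2) ∧
        g = ∑ i, a i * q i := fun a b c ha hb hc h =>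
    ⟨![a, b, c], fun i => by fin_cases i <;> assumption, by simpa [Fin.sum_univ_three] using h⟩
  fin_cases i
  · obtain ⟨a, b, c, ha, hb, hc, h⟩ := exists_eq_of_eval_ne_zero (hq 0) (hq 1) (hq 2) hz hi hg
    exact key a b c ha hb hc h
  · obtain ⟨a, b, c, ha, hb, hc, h⟩ := exists_eq_of_eval_ne_zero (hq 1) (hq 0) (hq 2)
      (fun x h1 h0 h2 => hz x h0 h1 h2) hi hg
    exact key b a c hb ha hc (by rw [h]; ring)
  · obtain ⟨a, b, c, ha, hb, hc, h⟩ := exists_eq_of_eval_ne_zero (hq 2) (hq 0) (hq 1)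
      (fun x h2 h0 h1 => hz x h0 h1 h2) hi hg
    exact key b c a hb hc ha (by rw [h]; ring)

/-- The second order Taylor expansion of a ternary cubic form. -/
theorem IsHomogeneous.exists_eval_add_eq {f : MvPolynomial (Fin 3) ℂ} (hf : f.IsHomogeneous 3) :
    ∃ A : Fin 3 → Fin 3 → Fin 3 → ℂ, ∀ x v : Fin 3 → ℂ,
      eval (x + v) f = eval x f + ∑ k, eval x (pderiv k f) * v k +
        ∑ i, ∑ j, v i * v j * ∑ l, A i j l * (3 * x l + v l) := by
  let B : Fin 3 → Fin 3 → Fin 3 → ℂ := fun i j l => eval 0 (pderiv l (pderiv j (pderiv i f)))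
  have h12 : ∀ i j l, B i j l = B j i l := fun i j l => by
    simp only [B, pderiv_pderiv_comm i j]
  have h23 : ∀ i j l, B i j l = B i l j := fun i j l => by
    simp only [B, pderiv_pderiv_comm j l]
  have hd : ∀ k x, eval x (pderiv k f) = ∑ i, ∑ j, 1 / 2 * B k i j * x i * x j := fun k x =>
    (hf.pderiv (i := k)).eval_eq_sum_of_two x
  have hv : ∀ x, eval x f = ∑ k, ∑ i, ∑ j, 1 / 6 * B k i j * x k * x i * x j := fun x => by
    have := hf.natCast_mul_eval x
    simp only [hd, Fin.sum_univ_three] at this ⊢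
    push_cast at this
    linear_combination this / 3
  -- By Euler, f is 1/6 of its symmetric tensor of third derivatives; the 3 in `3 * x l` counts the
  -- slots x can occupy.
  refine ⟨fun i j l => 1 / 6 * B i j l, fun x v => ?_⟩
  have e1 := h12 1 0
  have e2 := h12 2 0
  have e3 := h12 2 1
  simp only [hd, hv, Fin.sum_univ_three, Pi.add_apply, e1, e2, e3, h23 0 1 0, h23 0 2 0,
    h23 0 2 1, h23 1 2 1, h23 1 1 0, h23 1 2 0,
    h23 2 2 0, h23 2 2 1]
  ring

end MvPolynomial

/-! ### The Jacobian ideal of a smooth cubic -/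

section

open MvPolynomial

theorem IsSmoothPlaneCurve.eq_zero_of_eval_pderiv {f : MvPolynomial (Fin 3) ℂ} {d : ℕ}
    (hf : IsSmoothPlaneCurve f d) {x : Fin 3 → ℂ} (h : ∀ i, eval x (pderiv i f) = 0) : x = 0 := by
  by_contra hx
  have hd : (d : ℂ) ≠ 0 := Nat.cast_ne_zero.2 hf.pos.ne'
  have := hf.isHomogeneous.natCast_mul_eval x
  simp only [h, mul_zero, Finset.sum_const_zero, mul_eq_zero, hd, false_or] at this
  obtain ⟨i, hi⟩ := hf.smooth x hx this
  exact hi (h i)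

/-- Quartic monomials lie in the Jacobian ideal of a smooth plane cubic, with quadratic forms as
coefficients. -/
theorem IsSmoothPlaneCurve.exists_mul_eq_sum_pderiv {f : MvPolynomial (Fin 3) ℂ}
    (hf : IsSmoothPlaneCurve f 3) :
    ∃ D : Fin 3 → Fin 3 → Fin 3 → Fin 3 → Fin 3 → Fin 3 → Fin 3 → ℂ,
      ∀ (a b c d : Fin 3) (x : Fin 3 → ℂ), x a * x b * x c * x d =
        ∑ k, eval x (pderiv k f) * ∑ r, ∑ s, D a b c d k r s * x r * x s := by
  have key : ∀ a b c d : Fin 3, ∃ D : Fin 3 → Fin 3 → Fin 3 → ℂ, ∀ x : Fin 3 → ℂ,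
      x a * x b * x c * x d =
        ∑ k, eval x (pderiv k f) * ∑ r, ∑ s, D k r s * x r * x s := by
    intro a b c d
    have hg : (X a * X b * X c * X d : MvPolynomial (Fin 3) ℂ).IsHomogeneous 4 :=
      (((isHomogeneous_X ℂ a).mul (isHomogeneous_X ℂ b)).mul (isHomogeneous_X ℂ c)).mul
        (isHomogeneous_X ℂ d)
    obtain ⟨u, hu, h⟩ := exists_eq_sum_mul_of_isHomogeneous_four
      (fun i => hf.isHomogeneous.pderiv (i := i)) (fun x => hf.eq_zero_of_eval_pderiv) hg
    choose D hD using fun i => exists_eval_eq_of_isHomogeneous_two (hu i)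
    refine ⟨D, fun x => ?_⟩
    have := congrArg (eval x) h
    simp only [map_mul, eval_X, map_sum, hD] at this
    rw [this]
    exact Finset.sum_congr rfl fun k _ => mul_comm _ _
  choose D hD using key
  exact ⟨D, hD⟩

end

/-! ### Hadamard expansions of analytic functions -/

/-- Hadamard's lemma: g is the sum of the shifted power series. -/
theorem AnalyticAt.exists_eq_add_clm_apply {E F : Type*} [NormedAddCommGroup E] [NormedSpace ℂ E]
    [NormedAddCommGroup F] [NormedSpace ℂ F] [CompleteSpace F] {h : E → F}
    (hh : AnalyticAt ℂ h 0) :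
    ∃ g : E → E →L[ℂ] F, AnalyticAt ℂ g 0 ∧ ∀ᶠ x in 𝓝 0, h x = h 0 + g x x := by
  obtain ⟨p, r, hp⟩ := hh
  have hr : 0 < p.shift.radius := by
    rw [FormalMultilinearSeries.radius_shift]
    exact hp.r_pos.trans_le hp.r_le
  have hg := p.shift.hasFPowerSeriesOnBall hr
  refine ⟨p.shift.sum, hg.analyticAt, ?_⟩
  have hu := hg.unshift (z := h 0)
  filter_upwards [Metric.eball_mem_nhds 0 hp.r_pos, Metric.eball_mem_nhds 0 hr] with x hx hx'
  have h1 := hp.hasSum hx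
  have h2 := hu.hasSum hx'
  rw [zero_add] at h1 h2
  rw [sub_zero] at h2
  refine h1.unique ?_
  convert! h2 using 2 with n
  rcases n with _ | n
  · simp [FormalMultilinearSeries.unshift, ← hp.coeff_zero 0]
  · simp [FormalMultilinearSeries.unshift, FormalMultilinearSeries.shift]

theorem AnalyticAt.exists_eq_add_sum {ι : Type*} [Fintype ι] {h : (ι → ℂ) → ℂ}
    (hh : AnalyticAt ℂ h 0) :
    ∃ g : ι → (ι → ℂ) → ℂ, (∀ i, AnalyticAt ℂ (g i) 0) ∧
      ∀ᶠ x in 𝓝 0, h x = h 0 + ∑ i, x i * g i x := by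
  classical
  obtain ⟨g, hg, h⟩ := hh.exists_eq_add_clm_apply
  refine ⟨fun i x => g x (Pi.single i 1), fun i => ?_, h.mono fun x hx => ?_⟩
  · exact ((ContinuousLinearMap.apply ℂ ℂ (Pi.single i (1 : ℂ) : ι → ℂ)).analyticAt _).comp hg
  · rw [hx]
    congr 1
    conv_lhs => rw [← Finset.univ_sum_single x, map_sum]
    refine Finset.sum_congr rfl fun i _ => ?_
    rw [← smul_eq_mul, ← map_smul, ← Pi.single_smul, smul_eq_mul, mul_one,
      Finset.univ_sum_single]

theorem eq_zero_and_isBigO_of_add_mul_isBigO {a : ℂ} {u : ℂ → ℂ} (hu : Continuous u) {n : ℕ}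
    (h : (fun t => a + t * u t) =O[𝓝[≠] 0] fun t => t ^ (n + 1)) :
    a = 0 ∧ u =O[𝓝[≠] 0] fun t => t ^ n := by
  have ha : a = 0 := by
    have h1 : Tendsto (fun t => a + t * u t) (𝓝[≠] 0) (𝓝 (a + 0 * u 0)) :=
      (by fun_prop : Continuous fun t => a + t * u t).continuousAt.tendsto.mono_left
        nhdsWithin_le_nhds
    have h2 : Tendsto (fun t : ℂ => t ^ (n + 1)) (𝓝[≠] 0) (𝓝 (0 ^ (n + 1))) :=
      (by fun_prop : Continuous fun t : ℂ => t ^ (n + 1)).continuousAt.tendsto.mono_left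
        nhdsWithin_le_nhds
    rw [zero_pow n.succ_ne_zero] at h2
    rw [zero_mul, add_zero] at h1
    exact tendsto_nhds_unique h1 (h.trans_tendsto h2)
  refine ⟨ha, ?_⟩
  subst ha
  have := (isBigO_refl (fun t : ℂ => t⁻¹) (𝓝[≠] 0)).mul h
  refine this.congr' ?_ ?_
  · filter_upwards [self_mem_nhdsWithin] with t ht
    rw [zero_add, inv_mul_cancel_left₀ ht]
  · filter_upwards [self_mem_nhdsWithin] with t ht
    rw [pow_succ', inv_mul_cancel_left₀ ht]

theorem add_add_add_eq_zero_of_isBigO {a b c d : ℂ}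
    (h : (fun t => a + b * t + c * t ^ 2 + d * t ^ 3) =O[𝓝 0] fun t => t ^ 4) :
    a + b + c + d = 0 := by
  -- The trailing `t * 0` lets d be peeled off like the other coefficients.
  have h0 : (fun t => a + t * (b + t * (c + t * (d + t * 0)))) =O[𝓝[≠] 0] fun t => t ^ 4 :=
    (h.mono nhdsWithin_le_nhds).congr_left fun t => by ring
  obtain ⟨rfl, h1⟩ := eq_zero_and_isBigO_of_add_mul_isBigO (by fun_prop) h0
  obtain ⟨rfl, h2⟩ := eq_zero_and_isBigO_of_add_mul_isBigO (by fun_prop) h1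
  obtain ⟨rfl, h3⟩ := eq_zero_and_isBigO_of_add_mul_isBigO (by fun_prop) h2
  obtain ⟨rfl, -⟩ := eq_zero_and_isBigO_of_add_mul_isBigO (by fun_prop) h3
  ring

/-- An analytic function vanishing to order four at the origin is a combination of the quartic
monomials with analytic coefficients. -/
theorem AnalyticAt.exists_eq_sum_of_isBigO {ι : Type*} [Fintype ι] {h : (ι → ℂ) → ℂ}
    (hh : AnalyticAt ℂ h 0) (hO : h =O[𝓝 0] fun x => ‖x‖ ^ 4) :
    ∃ g : ι → ι → ι → ι → (ι → ℂ) → ℂ, (∀ a b c d, AnalyticAt ℂ (g a b c d) 0) ∧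
      ∀ᶠ x in 𝓝 0, h x = ∑ a, ∑ b, ∑ c, ∑ d, g a b c d x * (x a * x b * x c * x d) := by
  obtain ⟨g₁, hg₁, e₁⟩ := hh.exists_eq_add_sum
  choose g₂ hg₂ e₂ using fun a => (hg₁ a).exists_eq_add_sum
  choose g₃ hg₃ e₃ using fun a b => (hg₂ a b).exists_eq_add_sum
  choose g₄ hg₄ e₄ using fun a b c => (hg₃ a b c).exists_eq_add_sum
  simp only [← eventually_all] at e₂ e₃ e₄
  let P₁ : (ι → ℂ) → ℂ := fun x => ∑ a, x a * g₁ a 0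
  let P₂ : (ι → ℂ) → ℂ := fun x => ∑ a, x a * ∑ b, x b * g₂ a b 0
  let P₃ : (ι → ℂ) → ℂ := fun x => ∑ a, x a * ∑ b, x b * ∑ c, x c * g₃ a b c 0
  let P₄ : (ι → ℂ) → ℂ := fun x =>
    ∑ a, ∑ b, ∑ c, ∑ d, g₄ a b c d x * (x a * x b * x c * x d)
  have hP : ∀ᶠ x in 𝓝 0, h x = h 0 + P₁ x + P₂ x + P₃ x + P₄ x := by
    filter_upwards [e₁, e₂, e₃, e₄] with x h₁ h₂ h₃ h₄
    have h4 : P₄ x = ∑ a, x a * ∑ b, x b * ∑ c, x c * ∑ d, x d * g₄ a b c d x := by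
      simp only [P₄, Finset.mul_sum]
      refine Finset.sum_congr rfl fun a _ => Finset.sum_congr rfl fun b _ =>
        Finset.sum_congr rfl fun c _ => Finset.sum_congr rfl fun d _ => by ring
    rw [h₁, h4]
    simp only [h₂, h₃, h₄, mul_add, Finset.sum_add_distrib, P₁, P₂, P₃]
    ring
  have hx_le : ∀ (x : ι → ℂ) a, ‖x a‖ ≤ ‖x‖ := fun x a => norm_le_pi_norm x a
  have hP₄ : P₄ =O[𝓝 0] fun x => ‖x‖ ^ 4 := by
    refine IsBigO.fun_sum fun a _ => IsBigO.fun_sum fun b _ => IsBigO.fun_sum fun c _ =>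
      IsBigO.fun_sum fun d _ => ?_
    have hco : ∀ i, (fun x : ι → ℂ => x i) =O[𝓝 0] fun x => ‖x‖ := fun i =>
      IsBigO.of_norm_le fun x => by simpa using hx_le x i
    have := ((hg₄ a b c d).continuousAt.isBigO_one ℝ).mul
      ((((hco a).mul (hco b)).mul (hco c)).mul (hco d))
    refine this.congr_right fun x => by ring
  have hO' : (fun x => h 0 + P₁ x + P₂ x + P₃ x) =O[𝓝 0] fun x => ‖x‖ ^ 4 := by
    refine (hO.sub hP₄).congr' (hP.mono fun x hx => ?_) EventuallyEq.rfl
    simp only [hx]; ring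
  -- On the line t ↦ t • x the sum is a cubic polynomial in t of size O(t⁴), hence zero; take t = 1.
  have hzero : ∀ x, h 0 + P₁ x + P₂ x + P₃ x = 0 := by
    intro x
    apply add_add_add_eq_zero_of_isBigO
    have ht : Tendsto (fun t : ℂ => t • x) (𝓝 0) (𝓝 0) := by
      have := (by fun_prop : Continuous fun t : ℂ => t • x).tendsto 0
      rwa [zero_smul] at this
    have h1 := hO'.comp_tendsto ht
    refine (h1.congr_left fun t => ?_).trans ?_
    · have s1 : P₁ (t • x) = P₁ x * t := by
        simp only [P₁, Pi.smul_apply, smul_eq_mul, Finset.sum_mul]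
        exact Finset.sum_congr rfl fun a _ => by ring
      have s2 : P₂ (t • x) = P₂ x * t ^ 2 := by
        simp only [P₂, Pi.smul_apply, smul_eq_mul, Finset.sum_mul, Finset.mul_sum]
        exact Finset.sum_congr rfl fun a _ => Finset.sum_congr rfl fun b _ => by ring
      have s3 : P₃ (t • x) = P₃ x * t ^ 3 := by
        simp only [P₃, Pi.smul_apply, smul_eq_mul, Finset.sum_mul, Finset.mul_sum]
        exact Finset.sum_congr rfl fun a _ => Finset.sum_congr rfl fun b _ =>
          Finset.sum_congr rfl fun c _ => by ring
      simp only [Function.comp_apply, s1, s2, s3]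
    · refine IsBigO.of_bound (‖x‖ ^ 4) (Eventually.of_forall fun t => ?_)
      simp [norm_smul, mul_pow, mul_comm]
  refine ⟨g₄, hg₄, hP.mono fun x hx => ?_⟩
  rw [hx, hzero x, zero_add]

/-! ### Implicit and inverse functions -/

open scoped ContDiff

/-- Implicit function theorem for an equation `y + N (x, y) = b x`, where `N (0, y) = 0`. -/
theorem exists_analyticAt_add_eq {E Y : Type*} [NormedAddCommGroup E] [NormedSpace ℂ E]
    [CompleteSpace E] [NormedAddCommGroup Y] [NormedSpace ℂ Y] [CompleteSpace Y]
    {N : E × Y → Y} {b : E → Y} (hN : ContDiff ℂ ω N) (hN0 : ∀ y, N (0, y) = 0)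
    (hb : ContDiffAt ℂ ω b 0) :
    ∃ y : E → Y, ContDiffAt ℂ ω y 0 ∧ ∀ᶠ x in 𝓝 0, y x + N (x, y x) = b x := by
  let G : E × Y → Y := fun z => z.2 + N z - b z.1
  have hG : ContDiffAt ℂ ω G (0, b 0) := by
    have h1 : ContDiffAt ℂ ω (fun z : E × Y => b z.1) (0, b 0) :=
      ContDiffAt.comp (0, b 0) (f := Prod.fst) (g := b) hb contDiffAt_fst
    exact (contDiffAt_snd.add hN.contDiffAt).sub h1
  have hω : (ω : WithTop ℕ∞) ≠ 0 := by simp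
  -- On x = 0, `G` is y ↦ y − b 0, because N (0, y) = 0.
  have hinr : fderiv ℂ G (0, b 0) ∘L .inr ℂ E Y = .id ℂ Y := by
    have h1 : HasFDerivAt (fun y : Y => G (0, y)) (fderiv ℂ G (0, b 0) ∘L .inr ℂ E Y) (b 0) :=
      HasFDerivAt.comp (b 0) (f := fun y : Y => ((0 : E), y))
        (hG.differentiableAt hω).hasFDerivAt (hasFDerivAt_prodMk_right 0 (b 0))
    have h2 : HasFDerivAt (fun y : Y => G (0, y)) (.id ℂ Y) (b 0) := by
      simp only [G, hN0, add_zero]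
      exact (hasFDerivAt_id _).sub_const _
    exact h1.unique h2
  have hinv : (fderiv ℂ G (0, b 0) ∘L .inr ℂ E Y).IsInvertible := by
    rw [hinr]
    exact ⟨.refl ℂ Y, rfl⟩
  refine ⟨hG.implicitFunction hω hinv, hG.contDiffAt_implicitFunction hω hinv, ?_⟩
  filter_upwards [hG.eventually_apply_implicitFunction hω hinv] with x hx
  simpa [G, hN0, sub_eq_zero] using hx

/-- An analytic map tangent to the identity at a fixed point is locally biholomorphic there. -/
theorem ContDiffAt.exists_openPartialHomeomorph {E : Type*} [NormedAddCommGroup E]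
    [NormedSpace ℂ E] [CompleteSpace E] {Φ : E → E} {a : E} (hΦ : ContDiffAt ℂ ω Φ a)
    (h' : HasFDerivAt Φ (.id ℂ E) a) :
    ∃ e : OpenPartialHomeomorph E E, a ∈ e.source ∧ (e : E → E) = Φ ∧
      AnalyticOnNhd ℂ e e.source ∧ AnalyticOnNhd ℂ e.symm e.target := by
  have hω : (ω : WithTop ℕ∞) ≠ 0 := by simp
  have h'' : HasFDerivAt Φ ((ContinuousLinearEquiv.refl ℂ E : E ≃L[ℂ] E) : E →L[ℂ] E) a := h'
  let e := hΦ.toOpenPartialHomeomorph Φ h'' hω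
  have hae : a ∈ e.source := hΦ.mem_toOpenPartialHomeomorph_source h'' hω
  have hsymm : AnalyticAt ℂ e.symm (Φ a) := by
    have := e.contDiffAt_symm (f₀' := .refl ℂ E) (n := ω) (a := Φ a) (e.map_source hae)
      (by rw [show e.symm (Φ a) = a from e.left_inv hae]; exact h'')
      (by rw [show e.symm (Φ a) = a from e.left_inv hae]; exact hΦ)
    exact this.analyticAt
  -- Shrink the target, then the source, to the open sets where the inverse and Φ are analytic.
  let e₁ := (e.symm.restrOpen _ (isOpen_analyticAt ℂ e.symm)).symm
  let e₂ := e₁.restrOpen _ (isOpen_analyticAt ℂ Φ)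
  have hae₁ : a ∈ e₁.source :=  by
    have h1 : Φ a ∈ e₁.target := ⟨e.map_source hae, hsymm⟩
    have h2 : e₁.symm (Φ a) = a := e.left_inv hae
    simpa [h2] using e₁.map_target h1
  refine ⟨e₂, ⟨hae₁, hΦ.analyticAt⟩, rfl, fun x hx => hx.2, fun x hx => ?_⟩
  have hx1 : x ∈ e₁.target := hx.1
  exact hx1.2

/-! ### Construction of the coordinate change -/

theorem IsSmoothPlaneCurve.exists_tangent_id_eval_eq {f : MvPolynomial (Fin 3) ℂ}
    (hf : IsSmoothPlaneCurve f 3) {F : (Fin 3 → ℂ) → ℂ} (hF : AnalyticAt ℂ F 0)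
    (hO : (fun x => F x - MvPolynomial.eval x f) =O[𝓝 0] fun x => ‖x‖ ^ 4) :
    ∃ Φ : (Fin 3 → ℂ) → (Fin 3 → ℂ), Φ 0 = 0 ∧ ContDiffAt ℂ ω Φ 0 ∧
      HasFDerivAt Φ (.id ℂ _) 0 ∧ ∀ᶠ x in 𝓝 0, MvPolynomial.eval (Φ x) f = F x := by
  obtain ⟨g, hg, hgF⟩ := AnalyticAt.exists_eq_sum_of_isBigO
    (hF.sub (AnalyticOnNhd.eval_mvPolynomial f 0 (Set.mem_univ _))) hO
  obtain ⟨A, hA⟩ := hf.isHomogeneous.exists_eval_add_eq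
  obtain ⟨D, hD⟩ := hf.exists_mul_eq_sum_pderiv
  -- Here `φ` is the displacement v, and `Q` holds the quartic coefficients of the Taylor remainder.
  -- Rewriting quartic monomials by `D` turns the remainder into `N` and F − f into `β`. Since `ρ`
  -- vanishes at x = 0, so does `N`.
  let φ : (Fin 3 → ℂ) × (Fin 3 → Fin 3 → Fin 3 → ℂ) → Fin 3 → ℂ := fun z k => ∑ r, ∑ s, z.2 k r s * z.1 r * z.1 s
  let ρ : (Fin 3 → ℂ) × (Fin 3 → Fin 3 → Fin 3 → ℂ) → Fin 3 → Fin 3 → ℂ := fun z i j =>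
    ∑ l, A i j l * (3 * z.1 l + φ z l)
  let Q : (Fin 3 → ℂ) × (Fin 3 → Fin 3 → Fin 3 → ℂ) → Fin 3 → Fin 3 → Fin 3 → Fin 3 → ℂ := fun z a b c d =>
    ∑ i, ∑ j, z.2 i a b * z.2 j c d * ρ z i j
  let N : (Fin 3 → ℂ) × (Fin 3 → Fin 3 → Fin 3 → ℂ) → Fin 3 → Fin 3 → Fin 3 → ℂ := fun z => ∑ a, ∑ b, ∑ c, ∑ d, Q z a b c d • D a b c d
  let β : (Fin 3 → ℂ) → Fin 3 → Fin 3 → Fin 3 → ℂ := fun x => ∑ a, ∑ b, ∑ c, ∑ d, g a b c d x • D a b c d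
  have hφ : ContDiff ℂ ω φ := by
    refine contDiff_pi.2 fun k => ?_
    fun_prop
  have hρ : ∀ i j, ContDiff ℂ ω fun z => ρ z i j := fun i j => by
    have : ∀ l, ContDiff ℂ ω fun z => φ z l := fun l => contDiff_pi.1 hφ l
    fun_prop
  have hN : ContDiff ℂ ω N := by
    fun_prop
  have hβ : ContDiffAt ℂ ω β 0 := by
    have : ∀ a b c d, ContDiffAt ℂ ω (g a b c d) 0 := fun a b c d => (hg a b c d).contDiffAt
    fun_prop
  have hN0 : ∀ y, N (0, y) = 0 := fun y => by simp [N, Q, ρ, φ]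
  obtain ⟨y, hy, hyN⟩ := exists_analyticAt_add_eq hN hN0 hβ
  have hcomb : ∀ (x : Fin 3 → ℂ) (q : Fin 3 → Fin 3 → Fin 3 → Fin 3 → ℂ),
      ∑ a, ∑ b, ∑ c, ∑ d, q a b c d * (x a * x b * x c * x d) =
        ∑ k, MvPolynomial.eval x (MvPolynomial.pderiv k f) *
          φ (x, ∑ a, ∑ b, ∑ c, ∑ d, q a b c d • D a b c d) k := by
    intro x q
    let T : (Fin 3 → Fin 3 → Fin 3 → ℂ) →ₗ[ℂ] ℂ :=
      { toFun := fun y => ∑ k, MvPolynomial.eval x (MvPolynomial.pderiv k f) * φ (x, y) k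
        map_add' := fun y y' => by
          simp only [φ, Pi.add_apply, add_mul, Finset.sum_add_distrib, mul_add]
        map_smul' := fun c y => by
          simp only [φ, Pi.smul_apply, smul_eq_mul, Finset.mul_sum, RingHom.id_apply]
          refine Finset.sum_congr rfl fun k _ => Finset.sum_congr rfl fun r _ =>
            Finset.sum_congr rfl fun s _ => by ring }
    change _ = T _
    simp only [map_sum, map_smul, smul_eq_mul]
    simp only [hD]
    rfl
  have hquad : ∀ z : (Fin 3 → ℂ) × (Fin 3 → Fin 3 → Fin 3 → ℂ), ∑ i, ∑ j, φ z i * φ z j * ρ z i j =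
      ∑ a, ∑ b, ∑ c, ∑ d, Q z a b c d * (z.1 a * z.1 b * z.1 c * z.1 d) := by
    intro z
    have hswap : ∀ t : Fin 3 → Fin 3 → Fin 3 → ℂ,
        ∑ i, ∑ j, ∑ a, t i j a = ∑ a, ∑ i, ∑ j, t i j a := fun t => by
      rw [Finset.sum_comm (f := fun a i => ∑ j, t i j a)]
      exact Finset.sum_congr rfl fun i _ => Finset.sum_comm
    have hprod : ∀ i j, φ z i * φ z j * ρ z i j = ∑ a, ∑ b, ∑ c, ∑ d,
        z.2 i a b * z.2 j c d * ρ z i j * (z.1 a * z.1 b * z.1 c * z.1 d) := fun i j => by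
      rw [show φ z i = ∑ a, ∑ b, z.2 i a b * z.1 a * z.1 b from rfl]
      simp only [Finset.sum_mul]
      refine Finset.sum_congr rfl fun a _ => Finset.sum_congr rfl fun b _ => ?_
      rw [show φ z j = ∑ c, ∑ d, z.2 j c d * z.1 c * z.1 d from rfl]
      simp only [Finset.sum_mul, Finset.mul_sum]
      refine Finset.sum_congr rfl fun c _ => Finset.sum_congr rfl fun d _ => by ring
    simp only [hprod, Q, Finset.sum_mul]
    rw [hswap]
    refine Finset.sum_congr rfl fun a _ => ?_
    rw [hswap]
    refine Finset.sum_congr rfl fun b _ => ?_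
    rw [hswap]
    refine Finset.sum_congr rfl fun c _ => ?_
    rw [hswap]
  -- The displacement is O(‖x‖²), as y is bounded near 0.
  have hsmall : HasFDerivAt (fun x => φ (x, y x)) (0 : (Fin 3 → ℂ) →L[ℂ] Fin 3 → ℂ) 0 := by
    refine IsBigO.hasFDerivAt (n := 2) ?_ one_lt_two
    simp only [sub_zero]
    refine isBigO_pi.2 fun k => ?_
    refine IsBigO.fun_sum fun r _ => IsBigO.fun_sum fun s _ => ?_
    have hco : ∀ i, (fun x : Fin 3 → ℂ => x i) =O[𝓝 0] fun x => ‖x‖ := fun i =>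
      IsBigO.of_norm_le fun x => by simpa using norm_le_pi_norm x i
    have hyc : ContinuousAt (fun x => y x k r s) 0 :=
      continuousAt_pi.1 (continuousAt_pi.1 (continuousAt_pi.1 hy.continuousAt k) r) s
    refine (((hyc.isBigO_one ℝ).mul (hco r)).mul (hco s)).congr_right fun x => by ring
  refine ⟨fun x => x + φ (x, y x), by ext; simp [φ], ?_, ?_, ?_⟩
  · exact contDiffAt_id.add (hφ.contDiffAt.comp (0 : Fin 3 → ℂ) (contDiffAt_id.prodMk hy))
  · simpa using (hasFDerivAt_id (𝕜 := ℂ) (0 : Fin 3 → ℂ)).add hsmall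
  · filter_upwards [hgF, hyN] with x hx hxN
    have h1 : F x = MvPolynomial.eval x f +
        ∑ k, MvPolynomial.eval x (MvPolynomial.pderiv k f) * φ (x, y x + N (x, y x)) k := by
      rw [hxN, ← hcomb x fun a b c d => g a b c d x, ← hx]
      simp
    have hφadd : ∀ u v k, φ (x, u + v) k = φ (x, u) k + φ (x, v) k := fun u v k => by
      simp only [φ, Pi.add_apply, add_mul, Finset.sum_add_distrib]
    rw [h1, hA]
    have h2 := hquad (x, y x)
    rw [hcomb x (Q (x, y x))] at h2
    simp only [hφadd]
    simp only [mul_add (MvPolynomial.eval x _), Finset.sum_add_distrib]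
    rw [← add_assoc, add_right_inj]
    exact h2

theorem proposition3p4 (S : SurfaceGerm)
    (hS : S.HasIsolatedSingularity) (hmult : S.HasMultiplicity 3)
    (f : MvPolynomial (Fin 3) ℂ) (hC : IsSmoothPlaneCurve f 3) (hcone : S.HasTangentCone f) :
    S.AnalyticallyEquivalent (coneGerm f 3 hC) := by
  obtain ⟨d, -, hd, hO⟩ := hcone
  -- A nonzero form has only one degree.
  obtain rfl : d = 3 := hd.inj_right hC.isHomogeneous hC.ne_zero
  obtain ⟨Φ, hΦ0, hΦ, hΦ', hΦF⟩ := hC.exists_tangent_id_eval_eq S.analyticAt_eqn hO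
  obtain ⟨e, h0, rfl, he, hesymm⟩ := hΦ.exists_openPartialHomeomorph hΦ'
  refine ⟨e, h0, hΦ0, he, hesymm, fun _ => 1, analyticAt_const, one_ne_zero, ?_⟩
  filter_upwards [hΦF] with x hx
  rw [one_mul]
  exact hx
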